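/- A signed graph $\Gamma=(G,\sigma)$ consists of a finite simple graph $G$ (the underlying graph) and a sign function $\sigma:E(G)\to\{-1,+1\}$. The net-degree of a vertex is the number of its incident positive edges minus the number of its incident negative edges. The net Laplacian matrix is the real matrix $L^{\pm}(\Gamma)=D^{\pm}(\Gamma)-A(\Gamma)$, where $D^{\pm}(\Gamma)$ is the diagonal matrix of net-degrees and $A(\Gamma)$ is the signed adjacency matrix, whose $(u,v)$ entry is $\sigma(uv)$ if $uv\in E(G)$ and $0$ otherwise. The nullity $\eta(\Gamma)$ is the nullity of $L^{\pm}(\Gamma)$, that is, the multiplicity of $0$ as an eigenvalue of $L^{\pm}(\Gamma)$. For a cycle $C$ of $\Gamma$, let $m^+(C)$ and $m^-(C)$ be the numbers of positive and negative edges of $C$. A signed cactus graph is a signed graph whose underlying graph is connected and in which any two distinct cycles have no edge in common. For an edge $e$, $\Gamma-e$ is the signed graph obtained from $\Gamma$ by deleting $e$ and keeping all vertices and all other edges with their signs. Let $\Gamma$ be a signed cactus graph and let $e$ be an edge of $\Gamma$ that lies on a cycle of $\Gamma$. 1. If $m^+(C)=m^-(C)$ for every cycle $C$ of $\Gamma$,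 then $\eta(\Gamma-e)=\eta(\Gamma)-1$. 2. If $m^+(C)\neq m^-(C)$ for every cycle $C$ of $\Gamma$, then $\eta(\Gamma-e)=\eta(\Gamma)=1$. -/

import Mathlib

/-- A signed graph on the vertex set `V`: a simple graph (the underlying graph) together with a
sign `1` or `-1` for each of its edges. -/
structure SignedGraph (V : Type*) where
  graph : SimpleGraph V
  sign : graph.edgeSet → ℤˣ

namespace SignedGraph

noncomputable section

open scoped Classical in
/-- The adjacency matrix: the sign of the edge `uv` if `u` and `v` are adjacent, else `0`. -/
def adjMatrix {V : Type*} (Γ : SignedGraph V) : Matrix V V ℝ :=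
  Matrix.of fun u v =>
    if h : Γ.graph.Adj u v then
      (((Γ.sign ⟨s(u, v), Γ.graph.mem_edgeSet.mpr h⟩ : ℤˣ) : ℤ) : ℝ)
    else 0

/-- The number of neighbours of `v` that are joined to `v` by a positive edge. -/
def posDegree {V : Type*} (Γ : SignedGraph V) (v : V) : ℕ :=
  {w : V | ∃ h : Γ.graph.Adj v w,
    Γ.sign ⟨s(v, w), Γ.graph.mem_edgeSet.mpr h⟩ = 1}.ncard

/-- The number of neighbours of `v` that are joined to `v` by a negative edge. -/
def negDegree {V : Type*} (Γ : SignedGraph V) (v : V) : ℕ :=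
  {w : V | ∃ h : Γ.graph.Adj v w,
    Γ.sign ⟨s(v, w), Γ.graph.mem_edgeSet.mpr h⟩ = -1}.ncard

/-- The net-degree: positive degree minus negative degree. -/
def netDegree {V : Type*} (Γ : SignedGraph V) (v : V) : ℤ :=
  (Γ.posDegree v : ℤ) - (Γ.negDegree v : ℤ)

/-- The net Laplacian matrix: diagonal matrix of net-degrees minus adjacency matrix. -/
def netLaplacian {V : Type*} [DecidableEq V] (Γ : SignedGraph V) : Matrix V V ℝ :=
  Matrix.diagonal (fun v => (Γ.netDegree v : ℝ)) - Γ.adjMatrix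

/-- The nullity of a signed graph: the dimension of the kernel of its net Laplacian matrix.
Equivalently, the multiplicity of `0` as an eigenvalue: see `nullity_eq_rootMultiplicity`. -/
def nullity {V : Type*} [Fintype V] [DecidableEq V] (Γ : SignedGraph V) : ℕ :=
  Module.finrank ℝ (LinearMap.ker (Matrix.toLin' Γ.netLaplacian))

/-- The number of positive edges of a subgraph `H`. -/
def posEdges {V : Type*} (Γ : SignedGraph V) (H : Γ.graph.Subgraph) : ℕ :=
  {e : Γ.graph.edgeSet | (e : Sym2 V) ∈ H.edgeSet ∧ Γ.sign e = 1}.ncard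

/-- The number of negative edges of a subgraph `H`. -/
def negEdges {V : Type*} (Γ : SignedGraph V) (H : Γ.graph.Subgraph) : ℕ :=
  {e : Γ.graph.edgeSet | (e : Sym2 V) ∈ H.edgeSet ∧ Γ.sign e = -1}.ncard

/-- A subgraph is a cycle if it is the subgraph traced by a closed walk that is a cycle. -/
def IsCycleSubgraph {V : Type*} {G : SimpleGraph V} (C : G.Subgraph) : Prop :=
  ∃ (v : V) (p : G.Walk v v), p.IsCycle ∧ p.toSubgraph = C

/-- A signed cactus graph: the underlying graph is connected, and any two distinct cycles of it
have no edge in common. -/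
def IsCactus {V : Type*} (Γ : SignedGraph V) : Prop :=
  Γ.graph.Connected ∧
    ∀ C D : Γ.graph.Subgraph, IsCycleSubgraph C → IsCycleSubgraph D → C ≠ D →
      Disjoint C.edgeSet D.edgeSet

/-- The signed graph obtained by deleting the edge `e`, keeping all vertices and all other
edges with their signs. -/
def deleteEdge {V : Type*} (Γ : SignedGraph V) (e : Γ.graph.edgeSet) : SignedGraph V where
  graph := Γ.graph.deleteEdges {(e : Sym2 V)}
  sign := fun f =>
    Γ.sign ⟨(f : Sym2 V), SimpleGraph.edgeSet_mono (Γ.graph.deleteEdges_le _) f.2⟩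

theorem netLaplacian_isHermitian {V : Type*} [DecidableEq V] (Γ : SignedGraph V) :
    Γ.netLaplacian.IsHermitian := by
  refine (Matrix.isHermitian_diagonal _).sub ?_
  ext u v
  by_cases h : Γ.graph.Adj u v
  · simp [adjMatrix, h, h.symm, Sym2.eq_swap (a := u) (b := v)]
  · simp [adjMatrix, h, Γ.graph.adj_comm v u]

/-- The nullity is the multiplicity of `0` as an eigenvalue of the net Laplacian matrix. -/
theorem nullity_eq_rootMultiplicity {V : Type*} [Fintype V] [DecidableEq V]
    (Γ : SignedGraph V) : Γ.nullity = Γ.netLaplacian.charpoly.rootMultiplicity 0 := by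
  have hA := Γ.netLaplacian_isHermitian
  have h1 := LinearMap.finrank_range_add_finrank_ker (Matrix.toLin' Γ.netLaplacian)
  have h2 : Module.finrank ℝ (LinearMap.range (Matrix.toLin' Γ.netLaplacian)) =
      Fintype.card {i // hA.eigenvalues i ≠ 0} := hA.rank_eq_card_non_zero_eigs
  have h3 : Γ.netLaplacian.charpoly.rootMultiplicity 0 =
      Fintype.card {i // hA.eigenvalues i = 0} := by
    rw [← Polynomial.count_roots, hA.roots_charpoly_eq_eigenvalues, Multiset.count_map,
      Fintype.card_subtype]
    simp [Finset.card, eq_comm]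
  have h4 := Fintype.card_subtype_compl (fun i => hA.eigenvalues i = 0)
  have h5 := Fintype.card_subtype_le (fun i => hA.eigenvalues i = 0)
  rw [Module.finrank_fintype_fun_eq_card] at h1
  rw [h3]
  unfold nullity
  simp only [ne_eq] at h2
  omega

end

end SignedGraph

/-!
Assign to each pair of adjacent vertices `a`, `b` the flow `σ(ab) (y a - y b)` driven by a potential
`y`. Then `L y` is the net flow out of each vertex (`netLaplacian_mulVec`), so that the kernel of
the net Laplacian consists of the potentials whose flow is a circulation.

Cut equations describe these flows in a cactus. A bridge carries no circulation
(`eq_of_isBridge`), and two edges of a cycle form a cut (`not_reachable_of_mem_darts`). Hence, if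
`uv` is an edge of a cycle, `p` is the path from `u` to `v` along the rest of it, and
`L y = s (1_u - 1_v)`, then the flow through `uv` and the flow through any edge of `p` add up to
`s`. Summing potential differences along `p` gives the relation
`y u - y v = (s - σ(uv) (y u - y v)) ∑_{g ∈ p} σ(g)` (`sub_eq_mul_signSum_of_mulVec_eq`),
which is used for three values of `s`.

* For `s = σ(uv) (y u - y v)` the equation `L y = s (1_u - 1_v)` says that `y` is in the kernel of
  `L(Γ - uv)`. The relation gives `y u = y v`, so the kernel of `L(Γ - uv)` is the
  part of the kernel of `L(Γ)` on which `y u = y v` (`ker_deleteEdge`).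
* For `s = 0` it gives `(m⁺ - m⁻) (y u - y v) = 0`. If all cycles are unbalanced, the kernel of `L`
  consists of the constants (`ker_eq_span_one_of_unbalanced`), and nothing changes on deleting `uv`.
* For `s = 1` and a balanced cycle it is contradictory, so `1_u - 1_v` is not in the range of the
  symmetric matrix `L`; hence `y ↦ y u - y v` does not vanish on the kernel
  (`exists_mem_ker_ne_of_balanced`), and the nullity drops by exactly one on deleting `uv`.
-/

namespace SignedGraph

open Finset

/-! ### Edge weights and the net Laplacian as a flow operator -/

section Weights

variable {V : Type*} (Γ : SignedGraph V)

lemma adjMatrix_symm (u v : V) : Γ.adjMatrix u v = Γ.adjMatrix v u := by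
  by_cases h : Γ.graph.Adj u v
  · simp [adjMatrix, h, h.symm, Sym2.eq_swap (a := u) (b := v)]
  · simp [adjMatrix, h, Γ.graph.adj_comm v u]

lemma adjMatrix_of_not_adj {u v : V} (h : ¬ Γ.graph.Adj u v) : Γ.adjMatrix u v = 0 := by
  simp [adjMatrix, h]

lemma adjMatrix_of_adj {u v : V} (h : Γ.graph.Adj u v) :
    Γ.adjMatrix u v = (((Γ.sign ⟨s(u, v), h⟩ : ℤˣ) : ℤ) : ℝ) := by
  simp [adjMatrix, h]

lemma adjMatrix_mul_self {u v : V} (h : Γ.graph.Adj u v) :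
    Γ.adjMatrix u v * Γ.adjMatrix u v = 1 := by
  rw [adjMatrix_of_adj Γ h]
  rcases Int.units_eq_one_or (Γ.sign ⟨s(u, v), h⟩) with h | h <;> simp [h]

lemma sign_eq_iff {u v : V} (z : ℤˣ) :
    (∃ h : Γ.graph.Adj u v, Γ.sign ⟨s(u, v), Γ.graph.mem_edgeSet.mpr h⟩ = z) ↔
      Γ.adjMatrix u v = ((z : ℤ) : ℝ) := by
  by_cases h : Γ.graph.Adj u v
  · simp [adjMatrix_of_adj Γ h, h, Units.ext_iff]
  · have : ((z : ℤ) : ℝ) ≠ 0 := by exact_mod_cast z.ne_zero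
    simp [adjMatrix_of_not_adj Γ h, h, this.symm]

/-- Entries of the adjacency matrix lie in `{0, 1, -1}`, hence are differences of indicators. -/
lemma adjMatrix_eq_ite (u v : V) : Γ.adjMatrix u v =
    (if Γ.adjMatrix u v = 1 then 1 else 0) - (if Γ.adjMatrix u v = -1 then 1 else 0) := by
  by_cases h : Γ.graph.Adj u v
  · rcases mul_self_eq_one_iff.mp (adjMatrix_mul_self Γ h) with h | h <;> rw [h] <;> norm_num
  · rw [adjMatrix_of_not_adj Γ h]; norm_num

lemma netDegree_eq_sum [Fintype V] (u : V) : (Γ.netDegree u : ℝ) = ∑ v, Γ.adjMatrix u v := by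
  have h1 := fun v => sign_eq_iff Γ (u := u) (v := v) 1
  have h2 := fun v => sign_eq_iff Γ (u := u) (v := v) (-1)
  rw [sum_congr rfl fun v _ => adjMatrix_eq_ite Γ u v, sum_sub_distrib]
  simp only [netDegree, posDegree, negDegree, h1, h2, sum_boole, Set.ncard_eq_toFinset_card']
  simp

/-- The net Laplacian measures the net flow out of each vertex, where the flow along the edge
`ab` is the potential difference times the sign. -/
lemma netLaplacian_mulVec [Fintype V] [DecidableEq V] (y : V → ℝ) (a : V) :
    (Γ.netLaplacian.mulVec y) a = ∑ b, Γ.adjMatrix a b * (y a - y b) := by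
  simp only [netLaplacian, Matrix.sub_mulVec, Pi.sub_apply, Matrix.mulVec_diagonal,
    netDegree_eq_sum, mul_sub, sum_sub_distrib, sum_mul]
  rfl

end Weights

/-! ### Flows across cuts -/

section Cuts

variable {V : Type*}

/-- An edge leaving a connected component of `G - s` belongs to `s`. -/
lemma mem_of_reachable_of_not_reachable {G : SimpleGraph V} {s : Set (Sym2 V)} {u a b : V}
    (ha : (G.deleteEdges s).Reachable u a) (hb : ¬ (G.deleteEdges s).Reachable u b)
    (hab : G.Adj a b) : s(a, b) ∈ s := by
  by_contra h
  exact hb (ha.trans (SimpleGraph.Adj.reachable (SimpleGraph.deleteEdges_adj.mpr ⟨hab, h⟩)))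

variable [Fintype V] [DecidableEq V]

lemma sum_sum_eq_sum_cut (F : V → V → ℝ) (hF : ∀ a b, F a b = - F b a) (S : Finset V) :
    ∑ a ∈ S, ∑ b, F a b = ∑ x ∈ S ×ˢ Sᶜ, F x.1 x.2 := by
  have h0 : ∑ a ∈ S, ∑ b ∈ S, F a b = 0 := by
    -- Flows inside `S` cancel in pairs.
    have : ∑ a ∈ S, ∑ b ∈ S, F a b = - ∑ a ∈ S, ∑ b ∈ S, F a b := by
      conv_lhs => rw [sum_comm]
      simp only [← sum_neg_distrib]
      exact sum_congr rfl fun a _ => sum_congr rfl fun b _ => hF b a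
    linarith
  rw [sum_product]
  calc ∑ a ∈ S, ∑ b, F a b = ∑ a ∈ S, (∑ b ∈ S, F a b + ∑ b ∈ Sᶜ, F a b) :=
        sum_congr rfl fun a _ => (sum_add_sum_compl S _).symm
    _ = _ := by rw [sum_add_distrib, h0, zero_add]

/-- The net flow out of `S` is carried by any set `T` of ordered pairs leaving `S` which contains
all edges leaving `S`. -/
lemma sum_netLaplacian_mulVec_eq_sum_cut (Γ : SignedGraph V) (y : V → ℝ) (S : Finset V)
    (T : Finset (V × V)) (hT : T ⊆ S ×ˢ Sᶜ)
    (hcut : ∀ a ∈ S, ∀ b ∉ S, Γ.graph.Adj a b → (a, b) ∈ T) :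
    ∑ a ∈ S, (Γ.netLaplacian.mulVec y) a = ∑ x ∈ T, Γ.adjMatrix x.1 x.2 * (y x.1 - y x.2) := by
  simp only [netLaplacian_mulVec]
  rw [sum_sum_eq_sum_cut (fun a b => Γ.adjMatrix a b * (y a - y b))
    (fun a b => by rw [adjMatrix_symm Γ a b]; ring)]
  refine (sum_subset hT fun x hx hxT => ?_).symm
  rw [mem_product, mem_compl] at hx
  rw [adjMatrix_of_not_adj Γ fun h => hxT (hcut _ hx.1 _ hx.2 h), zero_mul]

/-- No flow crosses a bridge, if there are neither sources nor sinks. -/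
lemma eq_of_isBridge (Γ : SignedGraph V) {u v : V} (huv : Γ.graph.Adj u v)
    (hb : Γ.graph.IsBridge s(u, v)) {y : V → ℝ} (hy : Γ.netLaplacian.mulVec y = 0) :
    y u = y v := by
  classical
  rw [SimpleGraph.isBridge_iff] at hb
  have key := sum_netLaplacian_mulVec_eq_sum_cut Γ y
    (univ.filter fun w => (Γ.graph.deleteEdges {s(u, v)}).Reachable u w) {(u, v)}
    (by simpa using hb) (by
      intro a ha b hb' hab
      simp only [mem_filter, mem_univ, true_and] at ha hb'
      have h := mem_of_reachable_of_not_reachable ha hb' hab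
      rcases Sym2.eq_iff.mp (Set.mem_singleton_iff.mp h) with ⟨rfl, rfl⟩ | ⟨rfl, rfl⟩
      · simp
      · exact absurd ha hb)
  simp only [hy, Pi.zero_apply, sum_const_zero, sum_singleton] at key
  have h1 := adjMatrix_mul_self Γ huv
  have : (Γ.adjMatrix u v * Γ.adjMatrix u v) * (y u - y v) = 0 := by
    rw [mul_assoc, ← key, mul_zero]
  rw [h1] at this
  linarith

end Cuts

/-! ### Signs along walks -/

section Walks

variable {V : Type*}

lemma exists_eq_append_cons_of_mem_darts {G : SimpleGraph V} {u v : V} (p : G.Walk u v)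
    {d : G.Dart} (hd : d ∈ p.darts) :
    ∃ (q : G.Walk u d.fst) (r : G.Walk d.snd v), p = q.append (.cons d.adj r) := by
  induction p with
  | nil => simp at hd
  | cons h p ih =>
    rw [SimpleGraph.Walk.darts_cons, List.mem_cons] at hd
    rcases hd with rfl | hd
    · exact ⟨.nil, p, rfl⟩
    · obtain ⟨q, r, rfl⟩ := ih hd
      exact ⟨.cons h q, r, rfl⟩

/-- The sum of the signs of the edges of a walk. -/
noncomputable def signSum (Γ : SignedGraph V) {u v : V} (p : Γ.graph.Walk u v) : ℝ :=
  (p.darts.map fun d => Γ.adjMatrix d.fst d.snd).sum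

/-- A potential changing along each step of a walk by `c` times the sign of the step changes in
total by `c` times the sum of the signs. -/
lemma sub_eq_mul_signSum (Γ : SignedGraph V) {u v : V} (p : Γ.graph.Walk u v) (y : V → ℝ) (c : ℝ)
    (h : ∀ d ∈ p.darts, y d.fst - y d.snd = c * Γ.adjMatrix d.fst d.snd) :
    y u - y v = c * Γ.signSum p := by
  induction p with
  | nil => simp [signSum]
  | cons hab p ih =>
    have h1 := h ⟨(_, _), hab⟩ (by simp)
    have h2 := ih fun d hd => h d (by simp [hd])
    simp only [signSum, SimpleGraph.Walk.darts_cons, List.map_cons, List.sum_cons] at h1 h2 ⊢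
    linarith

lemma signSum_eq_posEdges_sub_negEdges (Γ : SignedGraph V) {u v : V} (p : Γ.graph.Walk u v)
    (hp : p.IsTrail) :
    Γ.signSum p = (Γ.posEdges p.toSubgraph : ℝ) - (Γ.negEdges p.toSubgraph : ℝ) := by
  classical
  let w : Sym2 V → ℝ := Sym2.lift ⟨Γ.adjMatrix, adjMatrix_symm Γ⟩
  have hw : Γ.signSum p = ∑ e ∈ p.edges.toFinset, w e := by
    rw [List.sum_toFinset _ hp.edges_nodup, SimpleGraph.Walk.edges, List.map_map]
    rfl
  have hcard : ∀ z : ℤˣ,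
      {e : Γ.graph.edgeSet | (e : Sym2 V) ∈ p.toSubgraph.edgeSet ∧ Γ.sign e = z}.ncard =
        (p.edges.toFinset.filter fun e => w e = ((z : ℤ) : ℝ)).card := by
    intro z
    rw [← Set.ncard_image_of_injective _ Subtype.val_injective, ← Set.ncard_coe_finset]
    congr 1
    ext e
    induction e with | _ a b =>
    have := sign_eq_iff Γ (u := a) (v := b) z
    simp only [Set.mem_image, Set.mem_ofPred_eq, Subtype.exists, coe_filter, List.mem_toFinset,
      SimpleGraph.Walk.mem_edges_toSubgraph]
    change _ ↔ _ ∧ Γ.adjMatrix a b = _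
    rw [← this]
    constructor
    · rintro ⟨_, h, ⟨h1, h2⟩, rfl⟩
      exact ⟨h1, h, h2⟩
    · rintro ⟨h1, h, h2⟩
      exact ⟨_, h, ⟨h1, h2⟩, rfl⟩
  have hw' : ∀ e, w e = (if w e = 1 then 1 else 0) - (if w e = -1 then 1 else 0) := by
    intro e
    induction e with | _ a b => exact adjMatrix_eq_ite Γ a b
  rw [hw, sum_congr rfl fun e _ => hw' e, sum_sub_distrib, posEdges, negEdges, hcard 1, hcard (-1)]
  simp

/-- An edge that is not a bridge is closed to a cycle `C` by a path `p`, and the signs of `C`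
sum to `m⁺(C) - m⁻(C)`. -/
lemma exists_path_of_not_isBridge (Γ : SignedGraph V) {u v : V}
    (huv : Γ.graph.Adj u v) (hb : ¬ Γ.graph.IsBridge s(u, v)) :
    ∃ p : Γ.graph.Walk u v, p.IsPath ∧ s(u, v) ∉ p.edges ∧
      ∃ C : Γ.graph.Subgraph, IsCycleSubgraph C ∧
        Γ.adjMatrix u v + Γ.signSum p = (Γ.posEdges C : ℝ) - (Γ.negEdges C : ℝ) := by
  classical
  rw [SimpleGraph.isBridge_iff_forall_walk_mem_edges] at hb
  push Not at hb
  obtain ⟨q, hq⟩ := hb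
  have he : s(u, v) ∉ q.bypass.edges := fun h => hq (q.edges_bypass_subset_edges h)
  have hD : (SimpleGraph.Walk.cons huv.symm q.bypass).IsCycle := by
    rw [SimpleGraph.Walk.cons_isCycle_iff]
    exact ⟨q.bypass_isPath, by rwa [Sym2.eq_swap]⟩
  refine ⟨q.bypass, q.bypass_isPath, he, _, ⟨_, _, hD, rfl⟩, ?_⟩
  rw [← signSum_eq_posEdges_sub_negEdges Γ _ hD.isTrail, adjMatrix_symm]
  simp [signSum]

end Walks

/-! ### The flow along a cycle of a cactus -/

section Cycle

variable {V : Type*}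

/-- In a cactus, two edges of a cycle form a cut: after deleting an edge of a cycle, every other
edge of that cycle is a bridge. -/
lemma not_reachable_of_mem_darts {Γ : SignedGraph V} (hΓ : Γ.IsCactus) {u v : V}
    (huv : Γ.graph.Adj u v) {p : Γ.graph.Walk u v} (hp : p.IsPath) (he : s(u, v) ∉ p.edges)
    {d : Γ.graph.Dart} (hd : d ∈ p.darts) :
    ¬ (Γ.graph.deleteEdges {s(u, v), d.edge}).Reachable d.fst d.snd := by
  intro h
  have hdp : d.edge ∈ p.edges := List.mem_map_of_mem hd
  have hne : d.edge ≠ s(u, v) := fun h => he (h ▸ hdp)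
  have hD : (SimpleGraph.Walk.cons huv.symm p).IsCycle := by
    rw [SimpleGraph.Walk.cons_isCycle_iff]
    exact ⟨hp, by rwa [Sym2.eq_swap]⟩
  -- A walk joining the ends of `d` would give a second cycle through `d`, one avoiding `uv`.
  have hadj : (Γ.graph.deleteEdges {s(u, v)}).Adj d.fst d.snd :=
    SimpleGraph.deleteEdges_adj.mpr ⟨d.adj, hne⟩
  have h' : ((Γ.graph.deleteEdges {s(u, v)}).deleteEdges {s(d.fst, d.snd)}).Reachable
      d.fst d.snd := by
    rw [SimpleGraph.deleteEdges_deleteEdges]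
    exact h
  obtain ⟨x, c, hc, hdc⟩ :=
    SimpleGraph.adj_and_reachable_delete_edges_iff_exists_cycle.mp ⟨hadj, h'⟩
  have hle : Γ.graph.deleteEdges {s(u, v)} ≤ Γ.graph := SimpleGraph.deleteEdges_le _
  have hec : s(u, v) ∉ (c.mapLe hle).edges := by
    rw [SimpleGraph.Walk.edges_mapLe_eq_edges]
    intro h
    have := c.edges_subset_edgeSet h
    simp at this
  by_cases hCD : (c.mapLe hle).toSubgraph = (SimpleGraph.Walk.cons huv.symm p).toSubgraph
  · apply hec
    rw [← SimpleGraph.Walk.mem_edges_toSubgraph, hCD, SimpleGraph.Walk.mem_edges_toSubgraph]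
    simp [Sym2.eq_swap]
  · have hdisj := hΓ.2 _ _ ⟨_, _, hc.mapLe hle, rfl⟩ ⟨_, _, hD, rfl⟩ hCD
    refine hdisj.notMem_of_mem_left (a := d.edge) ?_ ?_
    · rw [SimpleGraph.Walk.mem_edges_toSubgraph, SimpleGraph.Walk.edges_mapLe_eq_edges]
      exact hdc
    · rw [SimpleGraph.Walk.mem_edges_toSubgraph]
      simp [hdp]

variable [Fintype V] [DecidableEq V]

/-- If a flow of strength `s` enters a cactus at `u` and leaves at the adjacent vertex `v`, then
whatever does not run through the edge `uv` runs along the path that closes `uv` to a cycle. -/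
lemma adjMatrix_mul_sub_add_of_mem_darts {Γ : SignedGraph V} (hΓ : Γ.IsCactus) {u v : V}
    (huv : Γ.graph.Adj u v) {p : Γ.graph.Walk u v} (hp : p.IsPath) (he : s(u, v) ∉ p.edges)
    {y : V → ℝ} {s : ℝ} (hy : Γ.netLaplacian.mulVec y = s • (Pi.single u 1 - Pi.single v 1))
    {d : Γ.graph.Dart} (hd : d ∈ p.darts) :
    Γ.adjMatrix u v * (y u - y v) + Γ.adjMatrix d.fst d.snd * (y d.fst - y d.snd) = s := by
  classical
  have hcut := not_reachable_of_mem_darts hΓ huv hp he hd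
  obtain ⟨q, r, hqr⟩ := exists_eq_append_cons_of_mem_darts p hd
  have hnodup := hp.isTrail.edges_nodup
  rw [hqr] at hnodup he
  simp only [SimpleGraph.Walk.edges_append, SimpleGraph.Walk.edges_cons, List.mem_append,
    List.mem_cons, not_or, List.nodup_append, List.nodup_cons] at hnodup he
  obtain ⟨-, ⟨hdr, -⟩, hdq⟩ := hnodup
  obtain ⟨heq, hed, her⟩ := he
  have hua : (Γ.graph.deleteEdges {s(u, v), d.edge}).Reachable u d.fst := by
    refine ⟨q.toDeleteEdges _ fun e heq' hmem => ?_⟩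
    rcases hmem with rfl | hmem
    · exact heq heq'
    · exact hdq _ heq' _ (Or.inl rfl) hmem
  have hbv : (Γ.graph.deleteEdges {s(u, v), d.edge}).Reachable d.snd v := by
    refine ⟨r.toDeleteEdges _ fun e heq' hmem => ?_⟩
    rcases hmem with rfl | hmem
    · exact her heq'
    · rw [Set.mem_singleton_iff] at hmem
      exact hdr (by rw [hmem] at heq'; exact heq')
  have hub : ¬ (Γ.graph.deleteEdges {s(u, v), d.edge}).Reachable u d.snd :=
    fun h => hcut (hua.symm.trans h)
  have huv' : ¬ (Γ.graph.deleteEdges {s(u, v), d.edge}).Reachable u v :=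
    fun h => hub (h.trans hbv.symm)
  -- The only edges leaving the component of `u` in `G - uv - d` are `uv` and `d`.
  have key := sum_netLaplacian_mulVec_eq_sum_cut Γ y
    (univ.filter fun w => (Γ.graph.deleteEdges {s(u, v), d.edge}).Reachable u w)
    {(u, v), (d.fst, d.snd)}
    (by
      intro x hx
      rw [mem_insert, mem_singleton] at hx
      rcases hx with rfl | rfl
      · simpa using huv'
      · simpa using ⟨hua, hub⟩)
    (by
      intro a ha b hb' hab
      simp only [mem_filter, mem_univ, true_and] at ha hb'
      rcases mem_of_reachable_of_not_reachable ha hb' hab with h | h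
      · rcases Sym2.eq_iff.mp h with ⟨rfl, rfl⟩ | ⟨rfl, rfl⟩
        · simp
        · exact absurd ha huv'
      · rcases Sym2.eq_iff.mp (Set.mem_singleton_iff.mp h) with ⟨h1, h2⟩ | ⟨h1, h2⟩
        · simp [h1, h2]
        · exact absurd (h1 ▸ ha) hub)
  have hne : (u, v) ≠ (d.fst, d.snd) := by
    intro h
    rw [Prod.mk.injEq] at h
    exact hed (by rw [h.1, h.2])
  rw [sum_pair hne] at key
  rw [← key, hy]
  simp [← mul_sum, sum_sub_distrib, Pi.single_apply, huv']

/-- Ohm's law along the cycle formed by the edge `uv` and the path `p`: the flow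
`s - σ(uv) (y u - y v)` along `p`, times the total of the signs of `p`, is the potential difference
between the ends of `p`. -/
lemma sub_eq_mul_signSum_of_mulVec_eq {Γ : SignedGraph V} (hΓ : Γ.IsCactus) {u v : V}
    (huv : Γ.graph.Adj u v) {p : Γ.graph.Walk u v} (hp : p.IsPath) (he : s(u, v) ∉ p.edges)
    {y : V → ℝ} {s : ℝ} (hy : Γ.netLaplacian.mulVec y = s • (Pi.single u 1 - Pi.single v 1)) :
    y u - y v = (s - Γ.adjMatrix u v * (y u - y v)) * Γ.signSum p := by
  refine sub_eq_mul_signSum Γ p y _ fun d hd => ?_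
  have h1 := adjMatrix_mul_sub_add_of_mem_darts hΓ huv hp he hy hd
  have h2 := adjMatrix_mul_self Γ d.adj
  rw [← h1]
  linear_combination -(y d.fst - y d.snd) * h2

/-- If all cycles of a cactus are unbalanced, then no nonzero circulation arises from a
potential. -/
lemma eq_of_adj_of_unbalanced {Γ : SignedGraph V} (hΓ : Γ.IsCactus)
    (h : ∀ C : Γ.graph.Subgraph, IsCycleSubgraph C → Γ.posEdges C ≠ Γ.negEdges C)
    {y : V → ℝ} (hy : Γ.netLaplacian.mulVec y = 0) {u v : V} (huv : Γ.graph.Adj u v) :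
    y u = y v := by
  by_cases hb : Γ.graph.IsBridge s(u, v)
  · exact eq_of_isBridge Γ huv hb hy
  obtain ⟨p, hp, he, C, hC, hsum⟩ := exists_path_of_not_isBridge Γ huv hb
  have h1 := sub_eq_mul_signSum_of_mulVec_eq hΓ huv hp he (s := 0) (by rw [hy, zero_smul])
  have h2 := adjMatrix_mul_self Γ huv
  have h3 : (Γ.posEdges C : ℝ) - Γ.negEdges C ≠ 0 := by
    rw [sub_ne_zero]
    exact_mod_cast h C hC
  have h4 : ((Γ.posEdges C : ℝ) - Γ.negEdges C) * (y u - y v) = 0 := by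
    rw [← hsum]
    linear_combination Γ.adjMatrix u v * h1 - Γ.signSum p * (y u - y v) * h2
  have := (mul_eq_zero.mp h4).resolve_left h3
  linarith

end Cycle

/-! ### Kernels -/

section Kernel

/-- The linear functional `y ↦ y u - y v`. -/
def potentialDiff {V : Type*} (u v : V) : (V → ℝ) →ₗ[ℝ] ℝ :=
  (LinearMap.proj u : (V → ℝ) →ₗ[ℝ] ℝ) - LinearMap.proj v

@[simp]
lemma potentialDiff_apply {V : Type*} (u v : V) (y : V → ℝ) :
    potentialDiff u v y = y u - y v := rfl

variable {V : Type*}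

lemma deleteEdge_adjMatrix (Γ : SignedGraph V) (e : Γ.graph.edgeSet) (a b : V)
    [Decidable (s(a, b) = (e : Sym2 V))] :
    (Γ.deleteEdge e).adjMatrix a b = if s(a, b) = e then 0 else Γ.adjMatrix a b := by
  by_cases h : s(a, b) = e
  · rw [if_pos h, adjMatrix_of_not_adj]
    simp [deleteEdge, h]
  · rw [if_neg h]
    by_cases hab : Γ.graph.Adj a b
    · have hab' : (Γ.deleteEdge e).graph.Adj a b := SimpleGraph.deleteEdges_adj.mpr ⟨hab, h⟩
      rw [adjMatrix_of_adj _ hab', adjMatrix_of_adj _ hab]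
      rfl
    · rw [adjMatrix_of_not_adj _ hab, adjMatrix_of_not_adj]
      exact fun h => hab (SimpleGraph.deleteEdges_adj.mp h).1

variable [Fintype V] [DecidableEq V]

lemma netLaplacian_mulVec_eq_deleteEdge_add (Γ : SignedGraph V) {u v : V}
    (huv : Γ.graph.Adj u v) (y : V → ℝ) :
    Γ.netLaplacian.mulVec y = (Γ.deleteEdge ⟨s(u, v), huv⟩).netLaplacian.mulVec y +
      (Γ.adjMatrix u v * (y u - y v)) • (Pi.single u 1 - Pi.single v 1) := by
  have hne := huv.ne
  ext a
  simp only [Pi.add_apply, netLaplacian_mulVec, deleteEdge_adjMatrix, Pi.smul_apply, Pi.sub_apply,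
    smul_eq_mul]
  rw [← sub_eq_iff_eq_add', ← sum_sub_distrib]
  have : ∀ b, Γ.adjMatrix a b * (y a - y b) -
      (if s(a, b) = s(u, v) then 0 else Γ.adjMatrix a b) * (y a - y b) =
      if s(a, b) = s(u, v) then Γ.adjMatrix a b * (y a - y b) else 0 := by
    intro b; split_ifs <;> ring
  simp only [this]
  by_cases hau : a = u
  · subst hau
    have : ∀ b, s(a, b) = s(a, v) ↔ b = v := by simp
    simp [this, hne]
  by_cases hav : a = v
  · subst hav
    have : ∀ b, s(a, b) = s(u, a) ↔ b = u := by simp [Sym2.eq_swap (a := u)]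
    simp only [this, sum_ite_eq', mem_univ, if_true, Pi.single_apply, hau, if_false]
    rw [adjMatrix_symm]
    ring
  · have : ∀ b, s(a, b) ≠ s(u, v) := by
      intro b h
      rcases Sym2.eq_iff.mp h with h | h
      · exact hau h.1
      · exact hav h.1
    simp [this, hau, hav]

/-- In `Γ - uv` the path that closed `uv` to a cycle consists of bridges, so the potential has to
be equal at `u` and `v`. -/
lemma ker_deleteEdge {Γ : SignedGraph V} (hΓ : Γ.IsCactus) {u v : V}
    (huv : Γ.graph.Adj u v) (hb : ¬ Γ.graph.IsBridge s(u, v)) :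
    LinearMap.ker (Matrix.toLin' (Γ.deleteEdge ⟨s(u, v), huv⟩).netLaplacian) =
      LinearMap.ker (Matrix.toLin' Γ.netLaplacian) ⊓ LinearMap.ker (potentialDiff u v) := by
  ext y
  have hsum := netLaplacian_mulVec_eq_deleteEdge_add Γ huv y
  simp only [Submodule.mem_inf, LinearMap.mem_ker, Matrix.toLin'_apply,
    potentialDiff_apply]
  constructor
  · intro hy
    rw [hy, zero_add] at hsum
    obtain ⟨p, hp, he, -⟩ := exists_path_of_not_isBridge Γ huv hb
    have h := sub_eq_mul_signSum_of_mulVec_eq hΓ huv hp he hsum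
    rw [sub_self, zero_mul] at h
    rw [h, mul_zero, zero_smul] at hsum
    exact ⟨hsum, h⟩
  · rintro ⟨h1, h2⟩
    rw [h1, h2, mul_zero, zero_smul, add_zero] at hsum
    exact hsum.symm

/-- If all cycles of a cactus are balanced and the edge `uv` lies on a cycle, then some
kernel vector of the net Laplacian takes different values at `u` and `v`. If there were none, then,
by symmetry of the net Laplacian, a unit flow from `u` to `v` would arise from a
potential, contradicting Ohm's law along the cycle. -/
lemma exists_mem_ker_ne_of_balanced {Γ : SignedGraph V} (hΓ : Γ.IsCactus)
    (h : ∀ C : Γ.graph.Subgraph, IsCycleSubgraph C → Γ.posEdges C = Γ.negEdges C) {u v : V}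
    (huv : Γ.graph.Adj u v) (hb : ¬ Γ.graph.IsBridge s(u, v)) :
    ∃ y ∈ LinearMap.ker (Matrix.toLin' Γ.netLaplacian), potentialDiff u v y ≠ 0 := by
  by_contra! hcon
  have hmem : potentialDiff u v ∈ LinearMap.range (Matrix.toLin' Γ.netLaplacian).dualMap := by
    rw [LinearMap.range_dualMap_eq_dualAnnihilator_ker, Submodule.mem_dualAnnihilator]
    exact hcon
  -- Now `y u - y v = ψ (L y)`; representing `ψ` by a vector and transposing `L` gives the
  -- potential of a unit flow from `u` to `v`.
  obtain ⟨ψ, hψ⟩ := hmem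
  let y : V → ℝ := fun a => ψ (Pi.single a 1)
  have hψy : ∀ x, ψ x = x ⬝ᵥ y := by
    intro x
    rw [LinearMap.pi_apply_eq_sum_univ ψ x]
    refine sum_congr rfl fun a _ => ?_
    have : (fun j => if a = j then (1 : ℝ) else 0) = Pi.single a 1 := by
      ext j; simp [Pi.single_apply, eq_comm]
    rw [this, smul_eq_mul]
  have hsymm : Γ.netLaplacian.transpose = Γ.netLaplacian := by
    have := netLaplacian_isHermitian Γ
    rwa [Matrix.IsHermitian, Matrix.conjTranspose_eq_transpose_of_trivial] at this
  have hy : Γ.netLaplacian.mulVec y = (1 : ℝ) • (Pi.single u 1 - Pi.single v 1) := by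
    ext a
    have := LinearMap.congr_fun hψ (Pi.single a 1)
    rw [LinearMap.dualMap_apply, hψy, Matrix.toLin'_apply, dotProduct_comm,
      Matrix.dotProduct_mulVec, ← Matrix.mulVec_transpose, hsymm] at this
    simpa [Pi.single_comm, Pi.single_apply, eq_comm] using this
  obtain ⟨p, hp, he, C, hC, hsum⟩ := exists_path_of_not_isBridge Γ huv hb
  have h1 := sub_eq_mul_signSum_of_mulVec_eq hΓ huv hp he hy
  have h2 := adjMatrix_mul_self Γ huv
  rw [h C hC, sub_self] at hsum
  have h3 : Γ.signSum p = - Γ.adjMatrix u v := by linarith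
  rw [h3] at h1
  have h4 : Γ.adjMatrix u v = 0 := by linear_combination h1 + (y u - y v) * h2
  rw [h4] at h2
  norm_num at h2

lemma ker_eq_span_one_of_unbalanced {Γ : SignedGraph V} (hΓ : Γ.IsCactus)
    (h : ∀ C : Γ.graph.Subgraph, IsCycleSubgraph C → Γ.posEdges C ≠ Γ.negEdges C) :
    LinearMap.ker (Matrix.toLin' Γ.netLaplacian) = Submodule.span ℝ {(1 : V → ℝ)} := by
  ext y
  rw [LinearMap.mem_ker, Matrix.toLin'_apply, Submodule.mem_span_singleton]
  constructor
  · intro hy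
    obtain ⟨w⟩ := hΓ.1.nonempty
    refine ⟨y w, funext fun x => ?_⟩
    have hreach := hΓ.1.preconnected w x
    have : y w = y x := by
      obtain ⟨p⟩ := hreach
      induction p with
      | nil => rfl
      | cons hab _ ih => exact (eq_of_adj_of_unbalanced hΓ h hy hab).trans ih
    simp [this]
  · rintro ⟨c, rfl⟩
    ext a
    simp [netLaplacian_mulVec]

end Kernel

end SignedGraph

theorem mainTheorem2 {V : Type*} [Fintype V] [DecidableEq V] (Γ : SignedGraph V)
    (hΓ : Γ.IsCactus) (e : Γ.graph.edgeSet)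
    (he : ∃ C : Γ.graph.Subgraph, SignedGraph.IsCycleSubgraph C ∧ (e : Sym2 V) ∈ C.edgeSet) :
    ((∀ C : Γ.graph.Subgraph, SignedGraph.IsCycleSubgraph C → Γ.posEdges C = Γ.negEdges C) →
      ((Γ.deleteEdge e).nullity : ℤ) = (Γ.nullity : ℤ) - 1) ∧
    ((∀ C : Γ.graph.Subgraph, SignedGraph.IsCycleSubgraph C → Γ.posEdges C ≠ Γ.negEdges C) →
      (Γ.deleteEdge e).nullity = Γ.nullity ∧ Γ.nullity = 1) := by
  obtain ⟨e, huv⟩ := e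
  induction e with | _ u v =>
  obtain ⟨_, ⟨w, c, hc, rfl⟩, hec⟩ := he
  have hb : ¬ Γ.graph.IsBridge s(u, v) := fun hb =>
    hb.notMem_edges_of_isCycle hc (c.mem_edges_toSubgraph.mp hec)
  have hker := SignedGraph.ker_deleteEdge hΓ huv hb
  constructor
  · intro h
    obtain ⟨y, hy, hne⟩ := SignedGraph.exists_mem_ker_ne_of_balanced hΓ h huv hb
    set K := LinearMap.ker (Matrix.toLin' Γ.netLaplacian)
    have hf : (SignedGraph.potentialDiff u v).domRestrict K ≠ 0 := fun h0 =>
      hne (LinearMap.congr_fun h0 ⟨y, hy⟩)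
    have h1 := Module.Dual.finrank_ker_add_one_of_ne_zero hf
    have h2 : Module.finrank ℝ (LinearMap.ker ((SignedGraph.potentialDiff u v).domRestrict K)) =
        (Γ.deleteEdge ⟨s(u, v), huv⟩).nullity := by
      rw [SignedGraph.nullity, hker, LinearMap.ker_domRestrict,
        ← Submodule.map_comap_subtype, Submodule.finrank_map_subtype_eq]
    rw [h2] at h1
    have h3 : Γ.nullity = Module.finrank ℝ K := rfl
    rw [h3, ← h1]
    push_cast
    ring
  · intro h
    have hK := SignedGraph.ker_eq_span_one_of_unbalanced hΓ h
    have := hΓ.1.nonempty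
    refine ⟨?_, ?_⟩
    · rw [SignedGraph.nullity, hker, inf_eq_left.mpr, SignedGraph.nullity]
      rw [hK, Submodule.span_le]
      simp
    · rw [SignedGraph.nullity, hK, finrank_span_singleton one_ne_zero]
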